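/- Let $d,K$ be natural numbers and let $A_k, B_k$ ($k=1,\dots,K$) be complex positive semidefinite (Hermitian) $d\times d$ matrices such that $A_kB_k=B_kA_k$ for each $k$. Then, for every norm $|||\cdot|||$ on the complex $d\times d$ matrices that is unitarily invariant (that is, $|||UXV|||=|||X|||$ for all matrices $X$ and all unitary matrices $U,V$), \[ \Big|\Big|\Big|\sum_{k=1}^K A_kB_k\Big|\Big|\Big| \le \Big|\Big|\Big|\Big(\sum_{k=1}^K A_k\Big)\Big(\sum_{k=1}^K B_k\Big)\Big|\Big|\Big|. \] Moreover (and equivalently), the singular values of $\sum_k A_kB_k$ are weakly majorised by those of $(\sum_k A_k)(\sum_k B_k)$: writing $\sigma_1(X)\ge\dots\ge\sigma_d(X)$ for the singular values of $X$ with multiplicity, for each $j=1,\dots,d$, \[ \sum_{i=1}^j \sigma_i\Big(\sum_{k=1}^K A_kB_k\Big)\le\sum_{i=1}^j\sigma_i\Big(\Big(\sum_{k=1}^K A_k\Big)\Big(\sum_{k=1}^K B_k\Big)\Big). \] -/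

import Mathlib

open scoped ComplexOrder

/-- `x↓`: the vector with the same components as `x`, sorted in non-increasing order. -/
noncomputable def sortDecreasing {n : ℕ} (x : Fin n → ℝ) : Fin n → ℝ :=
  fun i => x (Tuple.sort x (Fin.rev i))

/-- Weak majorisation `x ≺_w y`: for each `k = 1, …, n`, the sum of the `k` largest components
of `x` is at most the sum of the `k` largest components of `y`. (An index `k : Fin n` counts from
zero, so `Finset.Iic k` runs over the first `k + 1` positions.) -/
def WeaklyMajorisedBy {n : ℕ} (x y : Fin n → ℝ) : Prop :=
  ∀ k : Fin n,
    ∑ i ∈ Finset.Iic k, sortDecreasing x i ≤ ∑ i ∈ Finset.Iic k, sortDecreasing y i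

/-- The vector of the `d` singular values of a complex `d × d` matrix, with multiplicity and
in non-increasing order. -/
noncomputable def singularValueVector {d : ℕ} (A : Matrix (Fin d) (Fin d) ℂ) : Fin d → ℝ :=
  fun i => (Matrix.toEuclideanLin A).singularValues (i : ℕ)

/-- A unitarily invariant norm on the complex `d × d` matrices: a seminorm that vanishes only at
zero (so a norm) and is unchanged by left and right multiplication by unitary matrices. -/
structure IsUnitarilyInvariantNorm {d : ℕ} (N : Seminorm ℂ (Matrix (Fin d) (Fin d) ℂ)) :
    Prop where
  eq_zero_of_map_eq_zero : ∀ A, N A = 0 → A = 0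
  map_unitary_mul_mul_unitary : ∀ U ∈ Matrix.unitaryGroup (Fin d) ℂ,
    ∀ V ∈ Matrix.unitaryGroup (Fin d) ℂ, ∀ A, N (U * A * V) = N A

/-! Write `A k = R k ^ 2` and `B k = Q k ^ 2` with commuting positive roots, and put `C k = Q k R k
≥ 0`, so that `A k B k = C k ^ 2`. Averaging over signs, `∑ C k ^ 2` is the mean of the squares of
the operators `H = ∑ ± C k`, and each of these satisfies `-S ≤ H ≤ S` for `S = ∑ C k`. By Ky Fan's
principle the largest squared eigenvalues of `H` are dominated in sum by those of `S`
(`sum_sq_norm_apply_le_of_abs_le`, `sum_sq_norm_add_sum_sq_norm_le`).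

With `R`, `Q` stacked into columns, `S = Q†R`, while `R†R = ∑ A k` and `Q†Q = ∑ B k`. The Weyl-type
bound `sum_sq_eigenvalue_le_sum_singularValues` then controls the squared eigenvalues of `S` by the
singular values of `(∑ A k)(∑ B k)`. This gives the majorisation; Ky Fan dominance turns it into the
norm inequality. -/

/-! ### Real vectors: capped weights, partial sums, signed permutations. -/

/-- A linear functional on a capped box is maximised at the superlevel sets. -/
theorem sum_mul_le_sum_of_threshold {ι : Type*} [Fintype ι] [DecidableEq ι] {x t : ι → ℝ}
    (s : Finset ι) {θ : ℝ} (hs : ∀ k ∈ s, θ ≤ x k) (hns : ∀ k ∉ s, x k ≤ θ)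
    (ht0 : ∀ k, 0 ≤ t k) (ht1 : ∀ k, t k ≤ 1) (hsum : θ * (∑ k, t k - s.card) ≤ 0) :
    ∑ k, x k * t k ≤ ∑ k ∈ s, x k := by
  have h1 : ∑ k ∈ s, x k = ∑ k, if k ∈ s then x k else 0 := by simp
  have h2 : ((s.card : ℕ) : ℝ) = ∑ k, if k ∈ s then (1 : ℝ) else 0 := by simp
  have h3 : ∑ k, x k * t k - ∑ k ∈ s, x k ≤ θ * (∑ k, t k - s.card) := by
    rw [h1, h2, ← Finset.sum_sub_distrib, ← Finset.sum_sub_distrib, Finset.mul_sum]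
    refine Finset.sum_le_sum fun k _ => ?_
    by_cases hk : k ∈ s
    · simp only [hk, if_true]
      nlinarith [hs k hk, ht1 k]
    · simp only [hk, if_false]
      nlinarith [hns k hk, ht0 k]
  linarith

theorem exists_finset_sum_mul_le {ι : Type*} [Fintype ι] (x t : ι → ℝ) (j : ℕ)
    (ht0 : ∀ k, 0 ≤ t k) (ht1 : ∀ k, t k ≤ 1) (hsum : ∑ k, t k ≤ j) :
    ∃ s : Finset ι, s.card ≤ j ∧ (∀ k ∈ s, 0 < x k) ∧ ∑ k, x k * t k ≤ ∑ k ∈ s, x k := by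
  classical
  obtain ⟨s, hs, hmax⟩ := Finset.exists_max_image
    (Finset.univ.filter fun s : Finset ι => s.card ≤ j) (fun s => ∑ k ∈ s, x k) ⟨∅, by simp⟩
  simp only [Finset.mem_filter, Finset.mem_univ, true_and] at hs hmax
  have hnn : ∀ k ∈ s, 0 ≤ x k := fun k hk => by
    have := hmax (s.erase k) ((Finset.card_erase_le).trans hs)
    linarith [Finset.add_sum_erase s x hk]
  have hins : s.card < j → ∀ l ∉ s, x l ≤ 0 := fun hlt l hl => by
    have := hmax (insert l s) (by rw [Finset.card_insert_of_notMem hl]; omega)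
    rw [Finset.sum_insert hl] at this
    linarith
  have hswap : ∀ k ∈ s, ∀ l ∉ s, x l ≤ x k := fun k hk l hl => by
    have hl' : l ∉ s.erase k := fun h => hl (Finset.mem_of_mem_erase h)
    have := hmax (insert l (s.erase k)) (by
      rw [Finset.card_insert_of_notMem hl', Finset.card_erase_of_mem hk]
      have := Finset.card_pos.2 ⟨k, hk⟩
      omega)
    rw [Finset.sum_insert hl'] at this
    linarith [Finset.add_sum_erase s x hk]
  have key : ∑ k, x k * t k ≤ ∑ k ∈ s, x k := by
    -- With room to spare the threshold is 0; otherwise it is the least selected value.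
    rcases hs.lt_or_eq with hlt | heq
    · exact sum_mul_le_sum_of_threshold (θ := 0) s hnn (hins hlt) ht0 ht1 (by simp)
    · rcases s.eq_empty_or_nonempty with rfl | hne
      · have hj : (j : ℝ) = 0 := by simp [← heq]
        have h0 : ∀ k ∈ Finset.univ, t k = 0 :=
          (Finset.sum_eq_zero_iff_of_nonneg fun k _ => ht0 k).1
            (le_antisymm (hj ▸ hsum) (Finset.sum_nonneg fun k _ => ht0 k))
        simp [fun k => h0 k (Finset.mem_univ k)]
      · obtain ⟨m, hm, hmin⟩ := Finset.exists_min_image s x hne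
        refine sum_mul_le_sum_of_threshold (θ := x m) s hmin (hswap m hm) ht0 ht1 ?_
        rw [heq]
        exact mul_nonpos_of_nonneg_of_nonpos (hnn m hm) (by linarith)
  -- Discarding nonpositive entries only increases the sum; strict positivity later gives nonzero
  -- eigenvalues.
  refine ⟨s.filter fun k => 0 < x k, (Finset.card_filter_le _ _).trans hs, by simp, key.trans ?_⟩
  rw [Finset.sum_filter]
  refine Finset.sum_le_sum fun k _ => ?_
  split_ifs with h
  · exact le_rfl
  · exact not_lt.1 h

/-- Abel summation against a nonincreasing weight. -/
theorem mul_sum_range_le_sum_mul {g z : ℕ → ℝ} {n : ℕ} (hg : Antitone g)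
    (hz : ∀ m ≤ n, 0 ≤ ∑ i ∈ Finset.range m, z i) :
    g n * ∑ i ∈ Finset.range n, z i ≤ ∑ i ∈ Finset.range n, g i * z i := by
  induction n with
  | zero => simp
  | succ n ih =>
    have h1 := ih fun m hm => hz m (hm.trans n.le_succ)
    have h2 := hz (n + 1) le_rfl
    have h3 := hg n.le_succ
    simp only [Finset.sum_range_succ] at h2 ⊢
    nlinarith [mul_nonneg (sub_nonneg.2 h3) h2]

theorem sum_mul_le_sum_mul_of_partial_sums {d : ℕ} {g x y : Fin d → ℝ} (hg : Antitone g)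
    (hg0 : ∀ i, 0 ≤ g i) (hxy : ∀ k, ∑ i ∈ Finset.Iic k, x i ≤ ∑ i ∈ Finset.Iic k, y i) :
    ∑ i, g i * x i ≤ ∑ i, g i * y i := by
  -- Extension by zero stays antitone since `g ≥ 0`, and `G d = 0` removes the boundary term of Abel
  -- summation.
  let G : ℕ → ℝ := fun i => if h : i < d then g ⟨i, h⟩ else 0
  let Z : ℕ → ℝ := fun i => if h : i < d then y ⟨i, h⟩ - x ⟨i, h⟩ else 0
  have hG : Antitone G := by
    intro a b hab
    by_cases hb : b < d
    · have ha : a < d := lt_of_le_of_lt hab hb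
      simp only [G, ha, hb, dif_pos]
      exact hg hab
    · by_cases ha : a < d
      · simp [G, ha, hb, hg0]
      · simp [G, ha, hb]
  have hZ : ∀ m ≤ d, 0 ≤ ∑ i ∈ Finset.range m, Z i := by
    intro m hm
    rcases m with _ | m
    · simp
    · have h := hxy ⟨m, hm⟩
      have : ∑ i ∈ Finset.range (m + 1), Z i = ∑ i ∈ Finset.Iic (⟨m, hm⟩ : Fin d), (y i - x i) := by
        refine (Finset.sum_bij (fun (i : Fin d) _ => (i : ℕ)) ?_ ?_ ?_ ?_).symm
        · intro a ha
          have : (a : ℕ) ≤ m := Fin.le_def.1 (Finset.mem_Iic.1 ha)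
          exact Finset.mem_range.2 (by omega)
        · intro a _ b _ hab
          exact Fin.ext hab
        · intro b hb
          have hb := Finset.mem_range.1 hb
          exact ⟨⟨b, by omega⟩, Finset.mem_Iic.2 (Fin.le_def.2 (by simp; omega)), rfl⟩
        · intro a _
          simp [Z]
      rw [this, Finset.sum_sub_distrib]
      exact sub_nonneg.2 h
  have h := mul_sum_range_le_sum_mul hG hZ
  have hGd : G d = 0 := by simp [G]
  rw [hGd, zero_mul, Finset.sum_range] at h
  have h' : ∑ i : Fin d, G i * Z i = ∑ i, g i * y i - ∑ i, g i * x i := by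
    rw [← Finset.sum_sub_distrib]
    refine Finset.sum_congr rfl fun i _ => ?_
    simp [G, Z, mul_sub]
  linarith

/-- Nonincreasing vectors ordered by partial sums: the smaller one is a convex combination of
signed permutations of the larger one. -/
theorem mem_convexHull_signed_perm {d : ℕ} {x y : Fin d → ℝ} (hx : Antitone x)
    (hx0 : ∀ i, 0 ≤ x i)
    (hxy : ∀ k, ∑ i ∈ Finset.Iic k, x i ≤ ∑ i ∈ Finset.Iic k, y i) :
    x ∈ convexHull ℝ (Set.range fun p : (Fin d → SignType) × Equiv.Perm (Fin d) =>
      fun i => (if p.1 i = -1 then (-1 : ℝ) else 1) * y (p.2 i)) := by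
  by_contra hmem
  have hfin := Set.finite_range fun p : (Fin d → SignType) × Equiv.Perm (Fin d) =>
      fun i => (if p.1 i = -1 then (-1 : ℝ) else 1) * y (p.2 i)
  obtain ⟨f, u, hfu, hux⟩ := _root_.geometric_hahn_banach_closed_point (convex_convexHull ℝ _)
    (hfin.isClosed_convexHull ℝ) hmem
  have hf : ∀ z : Fin d → ℝ, f z = ∑ i, f (Pi.single i 1) * z i := fun z => by
    conv_lhs => rw [← Finset.univ_sum_single z, map_sum]
    refine Finset.sum_congr rfl fun i _ => ?_
    have : (Pi.single i (z i) : Fin d → ℝ) = z i • Pi.single i 1 := by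
      rw [← Pi.single_smul]; simp
    rw [this, map_smul, smul_eq_mul, mul_comm]
  set c : Fin d → ℝ := fun i => f (Pi.single i 1) with hc
  let τ : Equiv.Perm (Fin d) := Tuple.sort fun i => -|c i|
  have hτ : Antitone fun i => |c (τ i)| := fun a b hab => by
    have := Tuple.monotone_sort (fun i => -|c i|) hab
    simpa using this
  -- The vertex maximising `f`: signs match those of `c`, and larger `|c i|` meet entries of `y`
  -- with smaller index. A sign of 0 counts as `+1`.
  have h1 := hfu _ (subset_convexHull ℝ _ ⟨(fun i => SignType.sign (c i), τ⁻¹), rfl⟩)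
  rw [hf] at h1 hux
  have h2 : ∑ i, f (Pi.single i 1) * ((if SignType.sign (c i) = -1 then (-1 : ℝ) else 1)
      * y (τ⁻¹ i)) = ∑ i, |c (τ i)| * y i := by
    rw [← Equiv.sum_comp τ]
    refine Finset.sum_congr rfl fun i _ => ?_
    rw [← mul_assoc, show τ⁻¹ (τ i) = i from τ.symm_apply_apply i]
    congr 1
    split_ifs with h
    · rw [abs_of_neg (sign_eq_neg_one_iff.1 h)]; simp [hc]
    · rw [abs_of_nonneg (not_lt.1 fun h' => h (sign_eq_neg_one_iff.2 h'))]; simp [hc]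
  have h3 : ∑ i, |c (τ i)| * x i ≤ ∑ i, |c (τ i)| * y i :=
    sum_mul_le_sum_mul_of_partial_sums hτ (fun _ => abs_nonneg _) hxy
  have h4 : ∑ i, |c i| * x i ≤ ∑ i, |c (τ i)| * x i := by
    have hm : Monovary (fun i => |c (τ i)|) x := fun i j hij =>
      hτ (le_of_not_gt fun h => absurd (hx h.le) (not_le.2 hij))
    have := hm.sum_comp_perm_mul_le_sum_mul (σ := τ⁻¹)
    simpa using this
  have h5 : ∑ i, c i * x i ≤ ∑ i, |c i| * x i :=
    Finset.sum_le_sum fun i _ => mul_le_mul_of_nonneg_right (le_abs_self _) (hx0 i)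
  have h6 := h2 ▸ h1
  linarith

/-! ### Orthonormal families, eigenvectors and Ky Fan's principle. -/

section InnerProductSpace

variable {E : Type*} [NormedAddCommGroup E] [InnerProductSpace ℂ E]

theorem sum_sq_norm_inner_le_one {ι κ : Type*} [Fintype ι] [Fintype κ]
    (b : OrthonormalBasis κ ℂ E) {v : ι → E} (hv : Orthonormal ℂ v) (k : κ) :
    ∑ i, ‖inner ℂ (b k) (v i)‖ ^ 2 ≤ 1 := by
  have h := hv.sum_inner_products_le (s := Finset.univ) (b k)
  simpa [b.orthonormal.1 k, norm_inner_symm] using h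

theorem sum_sum_sq_norm_inner {ι κ : Type*} [Fintype ι] [Fintype κ]
    (b : OrthonormalBasis κ ℂ E) {v : ι → E} (hv : Orthonormal ℂ v) :
    ∑ k, ∑ i, ‖inner ℂ (b k) (v i)‖ ^ 2 = Fintype.card ι := by
  rw [Finset.sum_comm]
  simp [b.sum_sq_norm_inner_right, hv.1]

theorem Orthonormal.linearIndependent_of_smul {ι F : Type*} [NormedAddCommGroup F]
    [InnerProductSpace ℂ F] {v : ι → E} (hv : Orthonormal ℂ v) {w : ι → F} (f : F →ₗ[ℂ] E)
    {c : ι → ℝ} (hc : ∀ i, c i ≠ 0) (h : ∀ i, f (w i) = (c i : ℂ) • v i) :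
    LinearIndependent ℂ w := by
  refine LinearIndependent.of_comp f ?_
  have h1 : f ∘ w = (fun i => Units.mk0 (c i : ℂ) (by exact_mod_cast hc i)) • v := by
    ext1 i
    exact h i
  rw [h1]
  exact hv.linearIndependent.units_smul _

/-- Orthonormalising a linearly independent family of eigenvectors keeps the eigenvalues on
the diagonal. -/
theorem exists_orthonormal_inner_eq_eigenvalue {m : ℕ} (T : E →ₗ[ℂ] E) {w : Fin m → E}
    (hw : LinearIndependent ℂ w) {c : Fin m → ℝ} (h : ∀ i, T (w i) = (c i : ℂ) • w i) :
    ∃ q : Fin m → E, Orthonormal ℂ q ∧ ∀ i, inner ℂ (q i) (T (q i)) = c i := by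
  refine ⟨InnerProductSpace.gramSchmidtNormed ℂ w,
    InnerProductSpace.gramSchmidtNormed_orthonormal hw, fun i => ?_⟩
  set g := InnerProductSpace.gramSchmidt ℂ w with hg
  set V := Submodule.span ℂ (w '' Set.Iio i) with hV
  have hVg : V = Submodule.span ℂ (g '' Set.Iio i) :=
    (InnerProductSpace.span_gramSchmidt_Iio ℂ w i).symm
  have hTV : ∀ x ∈ V, T x ∈ V := by
    intro x hx
    induction hx using Submodule.span_induction with
    | mem x hx =>
      obtain ⟨k, hk, rfl⟩ := hx
      rw [h]
      exact V.smul_mem _ (Submodule.subset_span ⟨k, hk, rfl⟩)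
    | zero => simp
    | add x y _ _ hx hy => rw [map_add]; exact V.add_mem hx hy
    | smul a x _ hx => rw [map_smul]; exact V.smul_mem _ hx
  have horth : ∀ x ∈ V, inner ℂ (g i) x = 0 := by
    intro x hx
    rw [hVg] at hx
    induction hx using Submodule.span_induction with
    | mem x hx =>
      obtain ⟨k, hk, rfl⟩ := hx
      exact InnerProductSpace.gramSchmidt_orthogonal ℂ w (ne_of_gt hk)
    | zero => simp
    | add x y _ _ hx hy => rw [inner_add_right, hx, hy, add_zero]
    | smul a x _ hx => rw [inner_smul_right, hx, mul_zero]
  have hp : w i - g i ∈ V := by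
    rw [hVg]
    have := InnerProductSpace.gramSchmidt_def' ℂ w i
    rw [sub_eq_of_eq_add' this]
    refine Submodule.sum_mem _ fun k hk => ?_
    rw [Submodule.starProjection_singleton]
    exact Submodule.smul_mem _ _ (Submodule.subset_span ⟨k, Finset.mem_Iio.1 hk, rfl⟩)
  -- `T` is triangular in the Gram–Schmidt basis: the bracket lies in the invariant subspace `V`,
  -- which is orthogonal to `g i`.
  have hT : T (g i) = (c i : ℂ) • g i + ((c i : ℂ) • (w i - g i) - T (w i - g i)) := by
    rw [map_sub, h, smul_sub]
    abel
  have hgi : inner ℂ (g i) (T (g i)) = c i * inner ℂ (g i) (g i) := by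
    rw [hT, inner_add_right, inner_smul_right,
      horth _ (V.sub_mem (V.smul_mem _ hp) (hTV _ hp)), add_zero]
  have hne : g i ≠ 0 := InnerProductSpace.gramSchmidt_ne_zero i hw
  have hne' : (‖g i‖ : ℂ) ≠ 0 := by exact_mod_cast norm_ne_zero_iff.2 hne
  simp only [InnerProductSpace.gramSchmidtNormed, ← hg]
  rw [map_smul, inner_smul_left, inner_smul_right, hgi, inner_self_eq_norm_sq_to_K]
  simp only [map_inv₀, Complex.conj_ofReal, RCLike.ofReal_eq_complex_ofReal]
  field_simp

/-- Ky Fan's maximum principle in coordinates. -/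
theorem exists_finset_sum_mul_sq_norm_inner_le {m : ℕ} {κ : Type*} [Fintype κ]
    (b : OrthonormalBasis κ ℂ E) {v : Fin m → E} (hv : Orthonormal ℂ v) (x : κ → ℝ) :
    ∃ s : Finset κ, s.card ≤ m ∧ (∀ k ∈ s, 0 < x k) ∧
      ∑ i, ∑ k, x k * ‖inner ℂ (b k) (v i)‖ ^ 2 ≤ ∑ k ∈ s, x k := by
  obtain ⟨s, h1, h2, h3⟩ := exists_finset_sum_mul_le x
    (fun k => ∑ i, ‖inner ℂ (b k) (v i)‖ ^ 2) m
    (fun k => Finset.sum_nonneg fun i _ => sq_nonneg _) (sum_sq_norm_inner_le_one b hv)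
    (by rw [sum_sum_sq_norm_inner b hv, Fintype.card_fin])
  refine ⟨s, h1, h2, le_of_eq_of_le ?_ h3⟩
  rw [Finset.sum_comm]
  simp_rw [Finset.mul_sum]

/-- Repackages the index set from Ky Fan's principle as a `Fin l` family; `P` carries the
eigenvector property along. Only `l ≤ m` survives because nonpositive terms were discarded. -/
theorem exists_orthonormal_of_finset {m : ℕ} {κ : Type*} [Fintype κ]
    (b : OrthonormalBasis κ ℂ E) {s : Finset κ} (hs : s.card ≤ m) {x : κ → ℝ} {c r : ℝ}
    (h : c ≤ ∑ k ∈ s, x k) (P : E → ℝ → Prop) (hP : ∀ k ∈ s, P (b k) (x k)) (hr : c = r) :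
    ∃ l ≤ m, ∃ (e : Fin l → E) (μ : Fin l → ℝ), Orthonormal ℂ e ∧ (∀ i, P (e i) (μ i)) ∧
      r ≤ ∑ i, μ i := by
  refine ⟨s.card, hs, fun i => b (s.equivFin.symm i), fun i => x (s.equivFin.symm i),
    b.orthonormal.comp _ (Subtype.val_injective.comp s.equivFin.symm.injective),
    fun i => hP _ (s.equivFin.symm i).2, ?_⟩
  rw [Equiv.sum_comp s.equivFin.symm (fun k : s => x k), Finset.sum_coe_sort s x, ← hr]
  exact h

/-- Adding positive summands to the dominating operator absorbs the sum of their squares. -/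
theorem sum_sq_norm_add_sum_sq_norm_le {m : ℕ} {κ : Type*} {C : κ → E →ₗ[ℂ] E}
    (hC : ∀ k, (C k).IsSymmetric) (hC0 : ∀ k x, 0 ≤ (inner ℂ x (C k x)).re)
    {v : Fin m → E} {r : ℝ} {S₀ : E →ₗ[ℂ] E}
    (hr : ∀ H : E →ₗ[ℂ] E, H.IsSymmetric →
      (∀ x, |(inner ℂ x (H x)).re| ≤ (inner ℂ x (S₀ x)).re) → ∑ i, ‖H (v i)‖ ^ 2 ≤ r)
    (s : Finset κ) (S : E →ₗ[ℂ] E) (hS : S + ∑ k ∈ s, C k = S₀) (H : E →ₗ[ℂ] E)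
    (hH : H.IsSymmetric) (hHS : ∀ x, |(inner ℂ x (H x)).re| ≤ (inner ℂ x (S x)).re) :
    ∑ i, (‖H (v i)‖ ^ 2 + ∑ k ∈ s, ‖C k (v i)‖ ^ 2) ≤ r := by
  classical
  induction s using Finset.induction_on generalizing S H with
  | empty =>
    simp only [Finset.sum_empty, add_zero] at hS ⊢
    exact hr H hH (hS ▸ hHS)
  | insert k s hk ih =>
    rw [Finset.sum_insert hk, ← add_assoc] at hS
    have h1 := ih (S + C k) hS (H + C k) (hH.add (hC k)) fun x => by
      simp only [LinearMap.add_apply, inner_add_right, Complex.add_re]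
      exact (abs_add_le _ _).trans (add_le_add (hHS x) (abs_of_nonneg (hC0 k x)).le)
    have h2 := ih (S + C k) hS (H - C k) (hH.sub (hC k)) fun x => by
      simp only [LinearMap.add_apply, LinearMap.sub_apply, inner_add_right, inner_sub_right,
        Complex.add_re, Complex.sub_re]
      exact (abs_sub _ _).trans (add_le_add (hHS x) (abs_of_nonneg (hC0 k x)).le)
    have h3 : ∀ i, ‖H (v i)‖ ^ 2 + ∑ k ∈ insert k s, ‖C k (v i)‖ ^ 2 =
        ((‖(H + C k) (v i)‖ ^ 2 + ∑ k ∈ s, ‖C k (v i)‖ ^ 2) +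
          (‖(H - C k) (v i)‖ ^ 2 + ∑ k ∈ s, ‖C k (v i)‖ ^ 2)) / 2 := fun i => by
      have := parallelogram_law_with_norm ℂ (H (v i)) (C k (v i))
      rw [Finset.sum_insert hk, LinearMap.add_apply, LinearMap.sub_apply]
      linarith
    rw [Finset.sum_congr rfl fun i _ => h3 i, ← Finset.sum_div, Finset.sum_add_distrib]
    linarith

variable [FiniteDimensional ℂ E]

theorem LinearMap.IsSymmetric.inner_eigenvectorBasis_apply {H : E →ₗ[ℂ] E} (hH : H.IsSymmetric)
    (k : Fin (Module.finrank ℂ E)) (x : E) :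
    inner ℂ (hH.eigenvectorBasis rfl k) (H x)
      = hH.eigenvalues rfl k * inner ℂ (hH.eigenvectorBasis rfl k) x := by
  rw [← hH, hH.apply_eigenvectorBasis, inner_smul_left]
  simp

/-- Ky Fan's principle for `H ^ 2`, diagonal in the eigenbasis of `H`. -/
theorem LinearMap.IsSymmetric.exists_sum_sq_norm_apply_le {H : E →ₗ[ℂ] E} (hH : H.IsSymmetric)
    {m : ℕ} {v : Fin m → E} (hv : Orthonormal ℂ v) :
    ∃ l ≤ m, ∃ (e : Fin l → E) (c : Fin l → ℝ), Orthonormal ℂ e ∧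
      (∀ i, c i ≠ 0 ∧ H (e i) = (c i : ℂ) • e i) ∧ ∑ i, ‖H (v i)‖ ^ 2 ≤ ∑ i, c i ^ 2 := by
  obtain ⟨s, h1, h2, h3⟩ := exists_finset_sum_mul_sq_norm_inner_le (hH.eigenvectorBasis rfl) hv
    (fun k => hH.eigenvalues rfl k ^ 2)
  obtain ⟨l, hl, e, μ, he, hμ, hsum⟩ := exists_orthonormal_of_finset (hH.eigenvectorBasis rfl) h1 h3
    (fun y t => ∃ c : ℝ, t = c ^ 2 ∧ c ≠ 0 ∧ H y = (c : ℂ) • y)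
    (fun k hk => ⟨hH.eigenvalues rfl k, rfl, by simpa using (h2 k hk).ne',
      hH.apply_eigenvectorBasis rfl k⟩) (r := ∑ i, ‖H (v i)‖ ^ 2) (by
      refine Finset.sum_congr rfl fun i _ => ?_
      rw [← (hH.eigenvectorBasis rfl).sum_sq_norm_inner_right]
      refine Finset.sum_congr rfl fun k _ => ?_
      rw [hH.inner_eigenvectorBasis_apply, norm_mul, mul_pow]
      simp)
  choose c hc using hμ
  exact ⟨l, hl, e, c, he, fun i => (hc i).2,
    hsum.trans_eq (Finset.sum_congr rfl fun i _ => (hc i).1)⟩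

/-- Ky Fan's principle for `T†T`, since `‖T v‖ ^ 2 = ⟪v, T†T v⟫`. -/
theorem LinearMap.exists_sum_sq_norm_apply_le {F : Type*} [NormedAddCommGroup F]
    [InnerProductSpace ℂ F] [FiniteDimensional ℂ F] (T : E →ₗ[ℂ] F)
    {m : ℕ} {v : Fin m → E} (hv : Orthonormal ℂ v) :
    ∃ l ≤ m, ∃ (e : Fin l → E) (c : Fin l → ℝ), Orthonormal ℂ e ∧
      (∀ i, c i ≠ 0 ∧ T.adjoint (T (e i)) = (c i : ℂ) • e i) ∧
      ∑ i, ‖T (v i)‖ ^ 2 ≤ ∑ i, c i := by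
  have hP := T.isSymmetric_adjoint_comp_self
  obtain ⟨s, h1, h2, h3⟩ := exists_finset_sum_mul_sq_norm_inner_le (hP.eigenvectorBasis rfl) hv
    (fun k => hP.eigenvalues rfl k)
  exact exists_orthonormal_of_finset (hP.eigenvectorBasis rfl) h1 h3
    (fun y t => t ≠ 0 ∧ T.adjoint (T y) = (t : ℂ) • y)
    (fun k hk => ⟨(h2 k hk).ne', hP.apply_eigenvectorBasis rfl k⟩) (by
      refine Finset.sum_congr rfl fun i _ => ?_
      have e1 : ((‖T (v i)‖ ^ 2 : ℝ) : ℂ) = inner ℂ (v i) ((T.adjoint ∘ₗ T) (v i)) := by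
        rw [LinearMap.comp_apply, LinearMap.adjoint_inner_right, inner_self_eq_norm_sq_to_K]
        simp
      have e2 := (hP.eigenvectorBasis rfl).sum_inner_mul_inner (v i) ((T.adjoint ∘ₗ T) (v i))
      apply Complex.ofReal_injective
      rw [e1, ← e2, Complex.ofReal_sum]
      refine Finset.sum_congr rfl fun k _ => ?_
      rw [hP.inner_eigenvectorBasis_apply, mul_left_comm, ← inner_conj_symm (v i),
        Complex.conj_mul']
      push_cast
      rfl)

end InnerProductSpace

/-! ### Singular values and the main inequality for operators. -/

section SingularValues

variable {E : Type*} [NormedAddCommGroup E] [InnerProductSpace ℂ E] [FiniteDimensional ℂ E]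

/-- Singular value decomposition. -/
theorem LinearMap.exists_orthonormalBasis_apply_eq_singularValues_smul (T : E →ₗ[ℂ] E) {n : ℕ}
    (hn : Module.finrank ℂ E = n) :
    ∃ a b : OrthonormalBasis (Fin n) ℂ E, ∀ i, T (b i) = (T.singularValues i : ℂ) • a i := by
  set b := T.isSymmetric_adjoint_comp_self.eigenvectorBasis hn with hb
  have hin : ∀ i j, inner ℂ (T (b i)) (T (b j)) =
      if i = j then (T.singularValues i : ℂ) ^ 2 else 0 := fun i j => by
    have h := T.isSymmetric_adjoint_comp_self.apply_eigenvectorBasis hn j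
    rw [← hb, ← T.sq_singularValues_fin hn j] at h
    rw [← LinearMap.adjoint_inner_right, ← LinearMap.comp_apply, h, inner_smul_right,
      orthonormal_iff_ite.1 b.orthonormal i j]
    split_ifs with hij
    · subst hij; simp
    · simp
  let v : Fin n → E := fun i => (T.singularValues i : ℂ)⁻¹ • T (b i)
  -- Where the singular value vanishes, `v` is 0 and is left out; completing to a basis fills those
  -- places.
  have hv : Orthonormal ℂ (({i | T.singularValues i ≠ 0} : Set (Fin n)).domRestrict v) := by
    rw [orthonormal_iff_ite]
    intro i j
    have hi : (T.singularValues (i : Fin n) : ℂ) ≠ 0 := by exact_mod_cast i.2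
    simp only [Set.domRestrict_apply, v, inner_smul_left, inner_smul_right, hin]
    by_cases hij : i = j
    · subst hij
      simp only [if_true, map_inv₀, Complex.conj_ofReal]
      field_simp
    · have : (i : Fin n) ≠ j := fun h => hij (Subtype.ext h)
      simp [hij, this]
  obtain ⟨a, ha⟩ := hv.exists_orthonormalBasis_extension_of_card_eq (by simpa using hn)
  refine ⟨a, b, fun i => ?_⟩
  by_cases hi : T.singularValues i = 0
  · have := hin i i
    rw [hi] at this
    simpa [hi] using this
  · rw [ha i hi]
    have hi' : (T.singularValues i : ℂ) ≠ 0 := by exact_mod_cast hi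
    simp only [v]
    rw [smul_inv_smul₀ hi']

/-- Ky Fan's bound: traces against partial isometries are at most the sum of the largest
singular values. -/
theorem LinearMap.sum_re_inner_le_sum_singularValues (T : E →ₗ[ℂ] E) {n : ℕ}
    (hn : Module.finrank ℂ E = n) {m : ℕ} {k : Fin n} (hm : m ≤ k + 1) {u v : Fin m → E}
    (hu : Orthonormal ℂ u) (hv : Orthonormal ℂ v) :
    ∑ i, (inner ℂ (u i) (T (v i))).re ≤ ∑ i ∈ Finset.Iic k, T.singularValues (i : ℕ) := by
  obtain ⟨a, b, hab⟩ := T.exists_orthonormalBasis_apply_eq_singularValues_smul hn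
  have hm' : (m : ℝ) ≤ ((k : ℕ) : ℝ) + 1 := by exact_mod_cast hm
  -- By AM-GM these weights bound the trace; they lie in `[0, 1]` and sum to `m`, at most the `k +
  -- 1` elements of `Iic k`.
  let t : Fin n → ℝ := fun l =>
    (∑ i, ‖inner ℂ (a l) (u i)‖ ^ 2 + ∑ i, ‖inner ℂ (b l) (v i)‖ ^ 2) / 2
  have h1 : ∑ i, (inner ℂ (u i) (T (v i))).re ≤ ∑ l : Fin n, T.singularValues (l : ℕ) * t l := by
    have : ∀ i, (inner ℂ (u i) (T (v i))).re ≤ ∑ l : Fin n, T.singularValues (l : ℕ) *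
        ((‖inner ℂ (a l) (u i)‖ ^ 2 + ‖inner ℂ (b l) (v i)‖ ^ 2) / 2) := fun i => by
      conv_lhs => rw [← b.sum_repr' (v i)]
      rw [map_sum, inner_sum, Complex.re_sum]
      refine Finset.sum_le_sum fun l _ => ?_
      rw [map_smul, hab, inner_smul_right, inner_smul_right, mul_left_comm, Complex.re_ofReal_mul]
      refine mul_le_mul_of_nonneg_left ?_ (T.singularValues_nonneg _)
      refine (Complex.re_le_norm _).trans ?_
      rw [norm_mul, norm_inner_symm (u i)]
      nlinarith [sq_nonneg (‖inner ℂ (a l) (u i)‖ - ‖inner ℂ (b l) (v i)‖)]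
    refine (Finset.sum_le_sum fun i _ => this i).trans_eq ?_
    rw [Finset.sum_comm]
    refine Finset.sum_congr rfl fun l _ => ?_
    rw [← Finset.mul_sum, ← Finset.sum_div, Finset.sum_add_distrib]
  refine h1.trans (sum_mul_le_sum_of_threshold (Finset.Iic k) (θ := T.singularValues (k : ℕ))
    (fun l hl => T.singularValues_antitone (Fin.le_def.1 (Finset.mem_Iic.1 hl)))
    (fun l hl => T.singularValues_antitone (Fin.le_def.1 (not_le.1 (mt Finset.mem_Iic.2 hl)).le))
    (fun l => by positivity) (fun l => ?_) ?_)
  · have h2 := sum_sq_norm_inner_le_one a hu l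
    have h3 := sum_sq_norm_inner_le_one b hv l
    simp only [t]
    linarith
  · refine mul_nonpos_of_nonneg_of_nonpos (T.singularValues_nonneg _) ?_
    simp only [t]
    rw [← Finset.sum_div, Finset.sum_add_distrib, sum_sum_sq_norm_inner a hu,
      sum_sum_sq_norm_inner b hv, Fin.card_Iic]
    simp
    linarith

/-- A Weyl-type inequality: nonzero eigenvalues of `L₂ L₁†` against singular values of
`L₁ L₁† L₂ L₂†`. -/
theorem sum_sq_eigenvalue_le_sum_singularValues {F : Type*} [NormedAddCommGroup F]
    [InnerProductSpace ℂ F] [FiniteDimensional ℂ F] (L₁ L₂ : F →ₗ[ℂ] E) {n : ℕ}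
    (hn : Module.finrank ℂ E = n) {m : ℕ} {k : Fin n} (hm : m ≤ k + 1) {e : Fin m → E}
    (he : Orthonormal ℂ e) {c : Fin m → ℝ} (hc : ∀ i, c i ≠ 0)
    (h : ∀ i, L₂ (L₁.adjoint (e i)) = (c i : ℂ) • e i) :
    ∑ i, c i ^ 2 ≤ ∑ i ∈ Finset.Iic k,
      ((L₁ ∘ₗ L₁.adjoint) ∘ₗ (L₂ ∘ₗ L₂.adjoint)).singularValues (i : ℕ) := by
  -- `L₁†` carries eigenvectors of `L₂L₁†` to eigenvectors of `L₁†L₂`, independently because the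
  -- eigenvalues are nonzero.
  obtain ⟨q, hq, hqc⟩ := exists_orthonormal_inner_eq_eigenvalue (L₁.adjoint ∘ₗ L₂)
    (w := fun i => L₁.adjoint (e i)) (he.linearIndependent_of_smul L₂ hc h)
    (fun i => by rw [LinearMap.comp_apply, h, map_smul])
  have h1 : ∑ i, c i ^ 2 ≤ ∑ i, ‖(L₁.adjoint ∘ₗ L₂) (q i)‖ ^ 2 := by
    refine Finset.sum_le_sum fun i _ => ?_
    have := norm_inner_le_norm (𝕜 := ℂ) (q i) ((L₁.adjoint ∘ₗ L₂) (q i))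
    rw [hqc, hq.1, one_mul, Complex.norm_real, Real.norm_eq_abs] at this
    rw [← sq_abs]
    gcongr
  obtain ⟨l, hl, e', c', he', hc', hsum⟩ := (L₁.adjoint ∘ₗ L₂).exists_sum_sq_norm_apply_le hq
  have h2 : ∀ i, L₂.adjoint (L₁ (L₁.adjoint (L₂ (e' i)))) = (c' i : ℂ) • e' i := fun i => by
    simpa [LinearMap.adjoint_comp] using (hc' i).2
  -- The same transfer by `L₂` reaches the adjoint of the target operator; conjugation does not
  -- affect its real diagonal entries.
  obtain ⟨q', hq', hqc'⟩ := exists_orthonormal_inner_eq_eigenvalue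
    ((L₂ ∘ₗ L₂.adjoint) ∘ₗ (L₁ ∘ₗ L₁.adjoint)) (w := fun i => L₂ (e' i))
    (he'.linearIndependent_of_smul (L₂.adjoint ∘ₗ L₁ ∘ₗ L₁.adjoint) (fun i => (hc' i).1) h2)
    (fun i => by simp only [LinearMap.comp_apply]; rw [h2, map_smul])
  refine h1.trans (hsum.trans (le_of_eq_of_le ?_ (LinearMap.sum_re_inner_le_sum_singularValues _ hn
    (hl.trans hm) hq' hq')))
  refine Finset.sum_congr rfl fun i _ => ?_
  have h3 := hqc' i
  simp only [LinearMap.comp_apply] at h3 ⊢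
  rw [← LinearMap.adjoint_inner_left, ← LinearMap.adjoint_inner_left,
    ← LinearMap.adjoint_inner_left, ← LinearMap.adjoint_inner_left] at h3
  simp only [LinearMap.adjoint_adjoint] at h3
  rw [← inner_conj_symm, Complex.conj_re, h3, Complex.ofReal_re]

/-- At a unit eigenvector `e` of `H`, `|c| = |⟪e, He⟫| ≤ ⟪e, Se⟫ ≤ ‖Se‖`. Ky Fan's principle is
applied to `H` before this comparison and to `S` after it. -/
theorem sum_sq_norm_apply_le_of_abs_le {m N : ℕ} {H S : E →ₗ[ℂ] E} (hH : H.IsSymmetric)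
    (hS : S.IsSymmetric) (hHS : ∀ x, |(inner ℂ x (H x)).re| ≤ (inner ℂ x (S x)).re)
    (hm : m ≤ N) {v : Fin m → E} (hv : Orthonormal ℂ v) :
    ∃ l ≤ N, ∃ (e : Fin l → E) (c : Fin l → ℝ), Orthonormal ℂ e ∧
      (∀ i, c i ≠ 0 ∧ S (e i) = (c i : ℂ) • e i) ∧ ∑ i, ‖H (v i)‖ ^ 2 ≤ ∑ i, c i ^ 2 := by
  obtain ⟨l, hl, e, c, he, hc, hsum⟩ := hH.exists_sum_sq_norm_apply_le hv
  obtain ⟨l', hl', e', c', he', hc', hsum'⟩ := hS.exists_sum_sq_norm_apply_le he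
  refine ⟨l', hl'.trans (hl.trans hm), e', c', he', hc', hsum.trans (le_trans ?_ hsum')⟩
  refine Finset.sum_le_sum fun i _ => ?_
  have h1 := hHS (e i)
  rw [(hc i).2, inner_smul_right, inner_self_eq_norm_sq_to_K, he.1] at h1
  have h2 := (Complex.re_le_norm _).trans (norm_inner_le_norm (𝕜 := ℂ) (e i) (S (e i)))
  rw [he.1, one_mul] at h2
  simp at h1
  rw [← sq_abs]
  exact pow_le_pow_left₀ (abs_nonneg _) (h1.trans h2) 2

/-- Ky Fan inequality for sums of products of commuting positive operators, given through square
roots `R k`, `Q k` of the factors. -/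
theorem sum_singularValues_sum_le {n : ℕ} (hn : Module.finrank ℂ E = n) {κ : Type*} [Fintype κ]
    {R Q : κ → E →ₗ[ℂ] E} (hR : ∀ k, (R k).IsSymmetric) (hQ : ∀ k, (Q k).IsSymmetric)
    (hRQ : ∀ k, R k ∘ₗ Q k = Q k ∘ₗ R k) (hpos : ∀ k x, 0 ≤ (inner ℂ x (Q k (R k x))).re)
    (k : Fin n) :
    ∑ i ∈ Finset.Iic k,
        (∑ k, (R k ∘ₗ R k) ∘ₗ (Q k ∘ₗ Q k)).singularValues (i : ℕ) ≤
      ∑ i ∈ Finset.Iic k,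
        ((∑ k, R k ∘ₗ R k) ∘ₗ (∑ k, Q k ∘ₗ Q k)).singularValues (i : ℕ) := by
  have hcomm : ∀ k x, R k (Q k x) = Q k (R k x) := fun k x => LinearMap.congr_fun (hRQ k) x
  set r := ∑ i ∈ Finset.Iic k,
        ((∑ k, R k ∘ₗ R k) ∘ₗ (∑ k, Q k ∘ₗ Q k)).singularValues (i : ℕ) with hr
  let C : κ → E →ₗ[ℂ] E := fun k => Q k ∘ₗ R k
  have hC : ∀ k, (C k).IsSymmetric := fun k x y => by
    simp only [C, LinearMap.comp_apply]
    rw [hQ, hR, hcomm]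
  have hS : (∑ k, C k).IsSymmetric := fun x y => by
    simp only [LinearMap.sum_apply, sum_inner, inner_sum]
    exact Finset.sum_congr rfl fun k _ => hC k x y
  -- The column operator `x ↦ (G k x)`, into the Hilbert sum of copies of `E`.
  let row : (κ → E →ₗ[ℂ] E) → E →ₗ[ℂ] PiLp 2 fun _ : κ => E := fun G =>
    (WithLp.linearEquiv 2 ℂ (κ → E)).symm.toLinearMap ∘ₗ LinearMap.pi G
  have hrow' : ∀ G G' : κ → E →ₗ[ℂ] E, (∀ k, (G k).IsSymmetric) →
      (row G).adjoint ∘ₗ row G' = ∑ k, G k ∘ₗ G' k := fun G G' hG => by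
    refine LinearMap.ext fun x => ext_inner_left ℂ fun y => ?_
    rw [LinearMap.comp_apply, LinearMap.adjoint_inner_right, PiLp.inner_apply,
      LinearMap.sum_apply, inner_sum]
    exact Finset.sum_congr rfl fun k _ => hG k _ _
  have hbound : ∀ m : ℕ, m ≤ k + 1 → ∀ v : Fin m → E, Orthonormal ℂ v → ∀ H : E →ₗ[ℂ] E,
      H.IsSymmetric → (∀ x, |(inner ℂ x (H x)).re| ≤ (inner ℂ x ((∑ k, C k) x)).re) →
      ∑ i, ‖H (v i)‖ ^ 2 ≤ r := by
    intro m hm v hv H hH hHS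
    obtain ⟨l, hl, e, c, he, hc, hsum⟩ := sum_sq_norm_apply_le_of_abs_le hH hS hHS hm hv
    refine hsum.trans ?_
    have := sum_sq_eigenvalue_le_sum_singularValues (row R).adjoint (row Q).adjoint hn hl he
      (fun i => (hc i).1) (fun i => by
        rw [LinearMap.adjoint_adjoint, ← LinearMap.comp_apply, hrow' Q R hQ]
        exact (hc i).2)
    rwa [LinearMap.adjoint_adjoint, LinearMap.adjoint_adjoint, hrow' R R hR, hrow' Q Q hQ] at this
  have hframe : ∀ m : ℕ, m ≤ k + 1 → ∀ v : Fin m → E, Orthonormal ℂ v →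
      ∑ i, ∑ k, ‖C k (v i)‖ ^ 2 ≤ r := by
    intro m hm v hv
    -- Starting from `H = S = 0`, all the `C k` are absorbed.
    simpa using sum_sq_norm_add_sum_sq_norm_le hC hpos (hbound m hm v hv) Finset.univ 0
      (zero_add _) 0 LinearMap.IsSymmetric.zero (by simp)
  obtain ⟨a, b, hab⟩ := (∑ k, (R k ∘ₗ R k) ∘ₗ (Q k ∘ₗ Q k)
    ).exists_orthonormalBasis_apply_eq_singularValues_smul hn
  have hk : (k : ℕ) + 1 ≤ n := k.2
  have hA := hframe (k + 1) le_rfl (fun i => a (Fin.castLE hk i))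
    (a.orthonormal.comp _ (Fin.castLE_injective hk))
  have hB := hframe (k + 1) le_rfl (fun i => b (Fin.castLE hk i))
    (b.orthonormal.comp _ (Fin.castLE_injective hk))
  have hIic : ∀ f : Fin n → ℝ, ∑ i ∈ Finset.Iic k, f i = ∑ i, f (Fin.castLE hk i) := fun f => by
    have : Finset.Iic k = Finset.univ.map (Fin.castLEEmb hk) := by
      ext i
      simp only [Finset.mem_Iic, Finset.mem_map, Finset.mem_univ, true_and, Fin.castLEEmb_apply]
      constructor
      · intro hi
        exact ⟨⟨i, Nat.lt_succ_of_le (Fin.le_def.1 hi)⟩, rfl⟩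
      · rintro ⟨j, rfl⟩
        exact Fin.le_def.2 (Nat.le_of_lt_succ j.2)
    rw [this, Finset.sum_map]
    rfl
  rw [hIic fun i => (∑ k, (R k ∘ₗ R k) ∘ₗ (Q k ∘ₗ Q k)).singularValues (i : ℕ)]
  -- At singular vectors, `σ i = ∑ Re ⟪C k a, C k b⟫`; AM-GM reduces this to the bound for the two
  -- frames.
  refine le_trans (Finset.sum_le_sum (g := fun i => ((∑ k, ‖C k (a (Fin.castLE hk i))‖ ^ 2) +
    ∑ k, ‖C k (b (Fin.castLE hk i))‖ ^ 2) / 2) fun i _ => ?_) ?_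
  · generalize Fin.castLE hk i = i
    have h1 : (inner ℂ (a i) ((∑ k, (R k ∘ₗ R k) ∘ₗ (Q k ∘ₗ Q k)) (b i))).re =
        (∑ k, (R k ∘ₗ R k) ∘ₗ (Q k ∘ₗ Q k)).singularValues (i : ℕ) := by
      rw [hab, inner_smul_right, inner_self_eq_norm_sq_to_K, a.orthonormal.1]
      simp
    rw [← h1, LinearMap.sum_apply, inner_sum, Complex.re_sum, ← Finset.sum_add_distrib,
      Finset.sum_div]
    refine Finset.sum_le_sum fun k _ => ?_
    have h2 : inner ℂ (a i) (((R k ∘ₗ R k) ∘ₗ (Q k ∘ₗ Q k)) (b i)) =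
        inner ℂ (C k (a i)) (C k (b i)) := by
      rw [hC k]
      simp only [C, LinearMap.comp_apply]
      rw [hcomm, hcomm, hcomm]
    rw [h2]
    have h3 := (Complex.re_le_norm _).trans
      (norm_inner_le_norm (𝕜 := ℂ) (C k (a i)) (C k (b i)))
    nlinarith [sq_nonneg (‖C k (a i)‖ - ‖C k (b i)‖)]
  · rw [← Finset.sum_div, Finset.sum_add_distrib]
    linarith

end SingularValues

/-! ### Majorisation of singular values and unitarily invariant norms. -/

theorem sortDecreasing_of_antitone {n : ℕ} {x : Fin n → ℝ} (hx : Antitone x) :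
    sortDecreasing x = x := by
  have h : x ∘ Fin.revPerm = x ∘ Tuple.sort x :=
    Tuple.comp_sort_eq_comp_iff_monotone.2 fun i j hij => hx (Fin.rev_le_rev.2 hij)
  ext i
  have := congrFun h (Fin.rev i)
  simpa [sortDecreasing] using this.symm

theorem antitone_singularValueVector {d : ℕ} (M : Matrix (Fin d) (Fin d) ℂ) :
    Antitone (singularValueVector M) := fun _ _ hij =>
  LinearMap.singularValues_antitone _ hij

theorem weaklyMajorisedBy_singularValueVector_iff {d : ℕ} {M M' : Matrix (Fin d) (Fin d) ℂ} :
    WeaklyMajorisedBy (singularValueVector M) (singularValueVector M') ↔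
      ∀ k, ∑ i ∈ Finset.Iic k, singularValueVector M i ≤
        ∑ i ∈ Finset.Iic k, singularValueVector M' i := by
  simp only [WeaklyMajorisedBy, sortDecreasing_of_antitone (antitone_singularValueVector _)]

namespace IsUnitarilyInvariantNorm

variable {d : ℕ} {N : Seminorm ℂ (Matrix (Fin d) (Fin d) ℂ)}

theorem map_eq_map_diagonal_singularValueVector (hN : IsUnitarilyInvariantNorm N)
    (M : Matrix (Fin d) (Fin d) ℂ) :
    N M = N (Matrix.diagonal fun i => (singularValueVector M i : ℂ)) := by
  obtain ⟨a, b, hab⟩ := (Matrix.toEuclideanLin M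
    ).exists_orthonormalBasis_apply_eq_singularValues_smul (n := d) (by simp)
  let e := EuclideanSpace.basisFun (Fin d) ℂ
  have hU := e.toMatrix_orthonormalBasis_mem_unitary a
  have hV := e.toMatrix_orthonormalBasis_mem_unitary b
  have hMV : M * e.toBasis.toMatrix b =
      e.toBasis.toMatrix a * Matrix.diagonal fun i => (singularValueVector M i : ℂ) := by
    ext i j
    have := congrArg (fun x : EuclideanSpace ℂ (Fin d) => x i) (hab j)
    rw [Matrix.mul_diagonal, Matrix.mul_apply]
    simp only [Module.Basis.toMatrix_apply]
    simpa [e, Matrix.toLpLin_apply, Matrix.mulVec, dotProduct, singularValueVector,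
      mul_comm] using this
  have hM : e.toBasis.toMatrix a * (Matrix.diagonal fun i => (singularValueVector M i : ℂ)) *
      star (e.toBasis.toMatrix b) = M := by
    rw [← hMV, mul_assoc, Matrix.mem_unitaryGroup_iff.1 hV, mul_one]
  conv_lhs => rw [← hM]
  exact hN.map_unitary_mul_mul_unitary _ hU _ (Unitary.star_mem hV) _

theorem signed_perm_mem_unitaryGroup {s : Fin d → ℂ} (hs : ∀ i, s i * star (s i) = 1)
    (π : Equiv.Perm (Fin d)) :
    (Matrix.of fun i j => if j = π i then s i else 0) ∈ Matrix.unitaryGroup (Fin d) ℂ := by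
  rw [Matrix.mem_unitaryGroup_iff]
  ext i j
  simp only [Matrix.mul_apply, Matrix.star_apply, Matrix.of_apply, Matrix.one_apply, ite_mul,
    zero_mul, Finset.sum_ite_eq', Finset.mem_univ, if_true,
    EmbeddingLike.apply_eq_iff_eq]
  by_cases hij : i = j
  · subst hij; simpa using hs i
  · simp [hij]

theorem map_diagonal_signed_perm (hN : IsUnitarilyInvariantNorm N) {s : Fin d → ℂ}
    (hs : ∀ i, s i * star (s i) = 1) (π : Equiv.Perm (Fin d)) (y : Fin d → ℂ) :
    N (Matrix.diagonal fun i => s i * y (π i)) = N (Matrix.diagonal y) := by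
  have h1 := signed_perm_mem_unitaryGroup hs π
  have h2 := Unitary.star_mem (signed_perm_mem_unitaryGroup (s := fun _ => 1) (by simp) π)
  -- The signs enter on the left factor only; the right one is the plain inverse permutation.
  rw [← hN.map_unitary_mul_mul_unitary _ h1 _ h2 (Matrix.diagonal y)]
  congr 1
  ext i j
  simp only [Matrix.mul_apply, Matrix.star_apply, Matrix.of_apply, Matrix.diagonal_apply, ite_mul,
    zero_mul, mul_ite, mul_zero, Finset.sum_ite_eq', Finset.mem_univ, if_true]
  by_cases hij : i = j
  · subst hij; simp
  · have : π i ≠ π j := fun h => hij (π.injective h)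
    simp [hij, this]

/-- Ky Fan's dominance theorem. -/
theorem le_of_sum_singularValueVector_le (hN : IsUnitarilyInvariantNorm N)
    {X Y : Matrix (Fin d) (Fin d) ℂ}
    (h : ∀ k, ∑ i ∈ Finset.Iic k, singularValueVector X i ≤
      ∑ i ∈ Finset.Iic k, singularValueVector Y i) : N X ≤ N Y := by
  rw [hN.map_eq_map_diagonal_singularValueVector X, hN.map_eq_map_diagonal_singularValueVector Y]
  set c := N (Matrix.diagonal fun i => (singularValueVector Y i : ℂ)) with hc
  let D : (Fin d → ℝ) → Matrix (Fin d) (Fin d) ℂ := fun x => Matrix.diagonal fun i => (x i : ℂ)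
  have hconv : Convex ℝ {x | N (D x) ≤ c} := by
    intro x hx y hy a b ha hb hab
    have hD : D (a • x + b • y) = (a : ℂ) • D x + (b : ℂ) • D y := by
      simp only [D, ← Matrix.diagonal_smul, Matrix.diagonal_add]
      congr 1
      ext i
      simp
    have hx : N (D x) ≤ c := hx
    have hy : N (D y) ≤ c := hy
    show N (D (a • x + b • y)) ≤ c
    rw [hD]
    refine (map_add_le_add N _ _).trans ?_
    rw [map_smul_eq_mul, map_smul_eq_mul, Complex.norm_real, Complex.norm_real,
      Real.norm_of_nonneg ha, Real.norm_of_nonneg hb]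
    calc a * N (D x) + b * N (D y) ≤ a * c + b * c := by gcongr
      _ = c := by rw [← add_mul, hab, one_mul]
  -- The sublevel set is convex and contains every signed permutation of the singular values of `Y`,
  -- hence also the singular values of `X`.
  refine convexHull_min ?_ hconv (mem_convexHull_signed_perm (antitone_singularValueVector X)
    (fun i => LinearMap.singularValues_nonneg _ _) h)
  rintro _ ⟨⟨s, π⟩, rfl⟩
  have := hN.map_diagonal_signed_perm (s := fun i => if s i = -1 then -1 else 1)
    (fun i => by split_ifs <;> simp) π (fun i => (singularValueVector Y i : ℂ))
  refine le_of_eq (Eq.trans ?_ this)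
  simp only [D]
  congr 2
  ext i
  split_ifs <;> simp

end IsUnitarilyInvariantNorm

/-! ### From operators back to matrices. -/

theorem Matrix.toEuclideanLin_mul {n : Type*} [Fintype n] [DecidableEq n] (X Y : Matrix n n ℂ) :
    Matrix.toEuclideanLin (X * Y) = Matrix.toEuclideanLin X ∘ₗ Matrix.toEuclideanLin Y := by
  ext x i
  simp [Matrix.toLpLin_apply, Matrix.mulVec_mulVec]

open scoped MatrixOrder in
-- Functional calculus preserves commutation, and a product of commuting positive matrices is
-- positive.
theorem Matrix.PosSemidef.exists_commuting_sqrt {n : Type*} [Fintype n] [DecidableEq n]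
    {A B : Matrix n n ℂ} (hA : A.PosSemidef) (hB : B.PosSemidef) (hAB : Commute A B) :
    ∃ R Q : Matrix n n ℂ, R.PosSemidef ∧ Q.PosSemidef ∧ R * R = A ∧ Q * Q = B ∧
      R * Q = Q * R ∧ (Q * R).PosSemidef := by
  have hR := Matrix.nonneg_iff_posSemidef.1 (CFC.sqrt_nonneg A)
  have hQ := Matrix.nonneg_iff_posSemidef.1 (CFC.sqrt_nonneg B)
  have h1 : Commute (CFC.sqrt A) B := hAB.cfcₙ_nnreal _
  have h2 : Commute (CFC.sqrt B) (CFC.sqrt A) := h1.symm.cfcₙ_nnreal _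
  exact ⟨CFC.sqrt A, CFC.sqrt B, hR, hQ, CFC.sqrt_mul_sqrt_self A hA.nonneg,
    CFC.sqrt_mul_sqrt_self B hB.nonneg, h2.symm.eq,
    Matrix.nonneg_iff_posSemidef.1
      (h2.mul_nonneg (CFC.sqrt_nonneg B) (CFC.sqrt_nonneg A))⟩

theorem sum_singularValueVector_sum_mul_le {d : ℕ} {κ : Type*} [Fintype κ]
    {A B : κ → Matrix (Fin d) (Fin d) ℂ} (hA : ∀ k, (A k).PosSemidef)
    (hB : ∀ k, (B k).PosSemidef) (hAB : ∀ k, Commute (A k) (B k)) (k : Fin d) :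
    ∑ i ∈ Finset.Iic k, singularValueVector (∑ k, A k * B k) i ≤
      ∑ i ∈ Finset.Iic k, singularValueVector ((∑ k, A k) * (∑ k, B k)) i := by
  choose R Q hR hQ hRA hQB hRQ hpos using fun k => (hA k).exists_commuting_sqrt (hB k) (hAB k)
  have h := sum_singularValues_sum_le (n := d) (by simp)
    (R := fun k => Matrix.toEuclideanLin (R k)) (Q := fun k => Matrix.toEuclideanLin (Q k))
    (fun k => Matrix.isSymmetric_toEuclideanLin_iff.2 (hR k).1)
    (fun k => Matrix.isSymmetric_toEuclideanLin_iff.2 (hQ k).1)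
    (fun k => by rw [← Matrix.toEuclideanLin_mul, hRQ, Matrix.toEuclideanLin_mul])
    (fun k x => by
      have := (Matrix.isPositive_toEuclideanLin_iff.2 (hpos k)).re_inner_nonneg_right x
      rwa [Matrix.toEuclideanLin_mul] at this) k
  simpa only [singularValueVector, ← Matrix.toEuclideanLin_mul, hRA, hQB, ← map_sum] using h

theorem theorem1 (d K : ℕ) (A B : Fin K → Matrix (Fin d) (Fin d) ℂ)
    (hA : ∀ k, (A k).PosSemidef) (hB : ∀ k, (B k).PosSemidef)
    (hAB : ∀ k, Commute (A k) (B k)) :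
    (∀ N : Seminorm ℂ (Matrix (Fin d) (Fin d) ℂ), IsUnitarilyInvariantNorm N →
      N (∑ k, A k * B k) ≤ N ((∑ k, A k) * (∑ k, B k))) ∧
    WeaklyMajorisedBy (singularValueVector (∑ k, A k * B k))
      (singularValueVector ((∑ k, A k) * (∑ k, B k))) := by
  have h := sum_singularValueVector_sum_mul_le hA hB hAB
  exact ⟨fun N hN => hN.le_of_sum_singularValueVector_le h,
    weaklyMajorisedBy_singularValueVector_iff.2 h⟩
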